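/- A left-order on a group $G$ is a strict total order $\prec$ on $G$ such that $a\prec b$ if and only if $ca\prec cb$, for all $a,b,c\in G$; its positive cone is $\{g\in G : 1\prec g\}$. A left-order is called regular if there are a finite set $X$, a surjective monoid homomorphism $\pi\colon X^*\to G$ from the free monoid on $X$, and a regular language $L\subseteq X^*$ (one accepted by a finite state automaton) such that $\pi(L)$ is the positive cone. Let $A$ and $B$ be groups that admit regular left-orders, and let $A*B$ be their free product. Then $(A*B)\times\mathbb{Z}$ admits a regular left-order. On the other hand, if $A$ and $B$ are both non-trivial, then $A*B$ itself does not admit a regular left-order. -/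

import Mathlib

universe u v

/-- A strict total order on a group, invariant under left multiplication. -/
structure IsLeftOrder (G : Type u) [Group G] (lt : G → G → Prop) : Prop where
  strictTotal : IsStrictTotalOrder G lt
  mul_left_iff : ∀ a b c : G, lt (c * a) (c * b) ↔ lt a b

/-- The positive cone of a left-order: the elements greater than the identity. -/
def positiveCone {G : Type u} [Group G] (lt : G → G → Prop) : Set G :=
  {g | lt 1 g}

/-- The evaluation `X* → G` of words over an alphabet `X`: the monoid homomorphism that extends
a map `X → G`. -/
def wordEval {G : Type u} [Group G] {X : Type v} (ev : X → G) (w : List X) : G :=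
  (w.map ev).prod

/-- A left-order is regular if there is a finite (monoid) generating set `X` of the group and a
regular language over `X` that evaluates onto the positive cone. (A finite alphabet can be taken
in `Type`.) -/
structure IsRegularLeftOrder (G : Type u) [Group G] (lt : G → G → Prop) : Prop where
  isLeftOrder : IsLeftOrder G lt
  exists_language : ∃ (X : Type) (_ : Finite X) (ev : X → G),
    Function.Surjective (wordEval ev) ∧
      ∃ L : Language X, L.IsRegular ∧ wordEval ev '' {w : List X | w ∈ L} = positiveCone lt

/-- The group admits a regular left-order. -/
def AdmitsRegularLeftOrder (G : Type u) [Group G] : Prop :=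
  ∃ lt : G → G → Prop, IsRegularLeftOrder G lt

/-!
Let `z` be the generator of `ℤ`. In `(A * B) × ℤ` take as letters of `A` the elements `a` and
`a⁻¹ z` with `1 < a`, and as letters of `B` the elements `b` and `b⁻¹ z⁻¹` with `1 < b`. The
letters of `A` form the interval between `1` and `z` in `A × ℤ`, ordered lexicographically with `ℤ`
leading, so a product of two of them is again one, one times `z`, or `z` itself; likewise for `B`
with `z⁻¹`. Hence every element is an alternating product of letters (possibly empty) times a power
`z ^ k`. Let it be positive if `0 ≤ k` and the product starts with a letter of `A`, or if `1 ≤ k`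
otherwise. The rules for products of letters make the positive elements a semigroup; exchanging `A`
with `B` and `z` with `z⁻¹` shows the same for the negative ones. The positive cone is rational
because it is built from rational sets by products, unions and generated submonoids.

In `A * B` the set `S` of elements whose reduced form starts in `A` is changed by each right
translation in finitely many elements only. Suppose a regular language evaluates onto a positive
cone. If `f < t` with `f` in `S` and `t` outside, a word of the language leads from `f` to `t`. It
leaves `S` at one of finitely many places, and from there one of finitely many words completes it
to a word of the language, so `f` lies below a bound that does not depend on `f` and `t`. But both
`S` and its complement are unbounded above.
-/

open scoped Pointwise Computability
open Monoid

/-! ### Regular languages -/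

section RegularLanguages

variable {α : Type u} {β : Type v} {L M : Language α}

theorem isRegular_of_finite (hL : Set.Finite L) : L.IsRegular := by
  refine .of_finite_range_leftQuotient ?_
  have hsuffixes : (⋃ w ∈ L, {y | y <:+ w}).Finite :=
    hL.biUnion fun w _ ↦ w.tails.finite_toSet.subset fun y hy ↦ (List.mem_tails y w).2 hy
  refine hsuffixes.finite_subsets.subset ?_
  rintro _ ⟨x, rfl⟩ y hy
  exact Set.mem_biUnion hy (List.suffix_append x y)

theorem isRegular_map (hL : L.IsRegular) (f : α → β) : (Language.map f L).IsRegular := by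
  refine .of_finite_range_leftQuotient <| (hL.finite_range_leftQuotient.finite_subsets.image
    fun 𝒦 ↦ ⨆ K ∈ 𝒦, Language.map f K).subset ?_
  rintro _ ⟨y, rfl⟩
  refine ⟨L.leftQuotient '' {x | x.map f = y}, Set.image_subset_range _ _, ?_⟩
  ext w
  simp only [iSup_image, Language.mem_iSup, Language.mem_leftQuotient]
  constructor
  · rintro ⟨x, rfl, u, hu, rfl⟩
    exact ⟨x ++ u, hu, List.map_append⟩
  · rintro ⟨t, ht, hty⟩
    obtain ⟨x, u, rfl, rfl, rfl⟩ := List.map_eq_append_iff.1 hty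
    exact ⟨x, rfl, u, ht, rfl⟩

theorem isRegular_mul (hL : L.IsRegular) (hM : M.IsRegular) : (L * M).IsRegular := by
  refine .of_finite_range_leftQuotient <| ((hL.finite_range_leftQuotient.prod
    hM.finite_range_leftQuotient.finite_subsets).image
    fun p ↦ p.1 * M + ⨆ K ∈ p.2, K).subset ?_
  rintro _ ⟨x, rfl⟩
  refine ⟨(L.leftQuotient x, M.leftQuotient '' {v | ∃ u ∈ L, u ++ v = x}),
    ⟨⟨x, rfl⟩, Set.image_subset_range _ _⟩, ?_⟩
  ext w
  simp only [Language.mem_add, Language.mem_mul, iSup_image, Language.mem_iSup,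
    Language.mem_leftQuotient]
  constructor
  · rintro (⟨u, hu, v, hv, rfl⟩ | ⟨v, ⟨u, hu, rfl⟩, hw⟩)
    · exact ⟨x ++ u, hu, v, hv, List.append_assoc ..⟩
    · exact ⟨u, hu, v ++ w, hw, (List.append_assoc ..).symm⟩
  · rintro ⟨u, hu, v, hv, huv⟩
    rcases List.append_eq_append_iff.1 huv with ⟨c, rfl, rfl⟩ | ⟨c, rfl, rfl⟩
    · exact .inr ⟨c, ⟨u, hu, rfl⟩, hv⟩
    · exact .inl ⟨c, hu, v, hv, rfl⟩

/- Working with `L + 1` instead of `L` treats a cut between two factors of a word of `L∗` like a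
cut inside a factor: it falls inside an empty one. -/
theorem isRegular_kstar (hL : L.IsRegular) : L∗.IsRegular := by
  have hL1 : (L + 1).IsRegular := hL.add (isRegular_of_finite (Set.finite_singleton []))
  have hL1_le : L + 1 ≤ L∗ := sup_le le_kstar one_le_kstar
  refine .of_finite_range_leftQuotient <| (hL1.finite_range_leftQuotient.finite_subsets.image
    fun 𝒦 ↦ (⨆ K ∈ 𝒦, K) * L∗).subset ?_
  rintro _ ⟨x, rfl⟩
  refine ⟨(L + 1).leftQuotient '' {v | ∃ u ∈ L∗, u ++ v = x}, Set.image_subset_range _ _, ?_⟩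
  ext w
  simp only [Language.mem_mul, iSup_image, Language.mem_iSup, Language.mem_leftQuotient]
  constructor
  · rintro ⟨a, ⟨v, ⟨u, hu, rfl⟩, hva⟩, b, hb, rfl⟩
    have huvab : u ++ ((v ++ a) ++ b) ∈ L∗ * (L∗ * L∗) :=
      Language.append_mem_mul hu (Language.append_mem_mul (hL1_le hva) hb)
    simpa only [kstar_mul_kstar, List.append_assoc] using huvab
  · intro hxw
    obtain ⟨S, hS, hSL⟩ := Language.mem_kstar.1 hxw
    obtain ⟨S₁, S₂, rfl, rfl, rfl⟩ | ⟨S₁, v, c, a, S₂, rfl, rfl, rfl⟩ :=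
      List.flatten_eq_append_iff.1 hS.symm
    · have hS₁ : S₁.flatten ∈ L∗ := Language.join_mem_kstar fun y hy ↦ hSL y (by simp [hy])
      have hS₂ : S₂.flatten ∈ L∗ := Language.join_mem_kstar fun y hy ↦ hSL y (by simp [hy])
      exact ⟨[], ⟨[], ⟨_, hS₁, List.append_nil _⟩, .inr rfl⟩, _, hS₂, rfl⟩
    · have hS₁ : S₁.flatten ∈ L∗ := Language.join_mem_kstar fun y hy ↦ hSL y (by simp [hy])
      have hS₂ : S₂.flatten ∈ L∗ := Language.join_mem_kstar fun y hy ↦ hSL y (by simp [hy])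
      have hva : v ++ c :: a ∈ L := hSL _ (by simp)
      exact ⟨c :: a, ⟨v, ⟨_, hS₁, rfl⟩, .inl hva⟩, _, hS₂, rfl⟩

theorem exists_finite_completions (hL : L.IsRegular) :
    ∃ C : Set (List α), C.Finite ∧ ∀ x y, x ++ y ∈ L → ∃ c ∈ C, x ++ c ∈ L :=
  ⟨(fun K : Language α ↦ Classical.epsilon (· ∈ K)) '' Set.range L.leftQuotient,
    hL.finite_range_leftQuotient.image _, fun x y hxy ↦
      ⟨_, Set.mem_image_of_mem _ ⟨x, rfl⟩,
        Classical.epsilon_spec (p := (· ∈ L.leftQuotient x)) ⟨y, hxy⟩⟩⟩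

end RegularLanguages

/-! ### Rational subsets -/

section WordEval

variable {G : Type u} [Group G] {X : Type v} (ev : X → G)

theorem wordEval_append (w w' : List X) :
    wordEval ev (w ++ w') = wordEval ev w * wordEval ev w' := by
  simp [wordEval]

theorem wordEval_cons (x : X) (w : List X) : wordEval ev (x :: w) = ev x * wordEval ev w := by
  simp [wordEval]

theorem wordEval_map {Y : Type*} (f : Y → X) (w : List Y) :
    wordEval ev (w.map f) = wordEval (ev ∘ f) w := by
  simp [wordEval]

theorem map_wordEval {H : Type*} [Group H] (f : G →* H) (w : List X) :
    f (wordEval ev w) = wordEval (f ∘ ev) w := by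
  simp [wordEval, map_list_prod]

theorem wordEval_inv_reverse (w : List X) :
    wordEval (fun x ↦ (ev x)⁻¹) w.reverse = (wordEval ev w)⁻¹ := by
  simp [wordEval, List.prod_inv_reverse, Function.comp_def]

end WordEval

/-- The rational subsets of a group are the images of the regular languages over finite
alphabets. -/
def IsRationalSubset {G : Type u} [Group G] (R : Set G) : Prop :=
  ∃ (X : Type) (_ : Finite X) (ev : X → G) (L : Language X),
    L.IsRegular ∧ wordEval ev '' {w | w ∈ L} = R

namespace IsRationalSubset

variable {G : Type u} [Group G] {R S : Set G}

theorem singleton (g : G) : IsRationalSubset {g} :=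
  ⟨Unit, inferInstance, fun _ ↦ g, {[()]}, isRegular_of_finite (Set.finite_singleton [()]),
    (Set.image_singleton (a := [()])).trans (by simp [wordEval])⟩

theorem image {H : Type v} [Group H] (hR : IsRationalSubset R) (f : G →* H) :
    IsRationalSubset (f '' R) := by
  obtain ⟨X, hX, ev, L, hL, rfl⟩ := hR
  refine ⟨X, hX, f ∘ ev, L, hL, ?_⟩
  ext g
  simp [map_wordEval]

theorem inv (hR : IsRationalSubset R) : IsRationalSubset R⁻¹ := by
  obtain ⟨X, hX, ev, L, hL, rfl⟩ := hR
  refine ⟨X, hX, fun x ↦ (ev x)⁻¹, L.reverse, hL.reverse, ?_⟩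
  rw [← Set.image_inv_eq_inv, Set.image_image]
  simp only [← wordEval_inv_reverse]
  ext g
  exact List.reverse_surjective.exists.trans (by simp [Language.mem_reverse])

theorem exists_common_alphabet (hR : IsRationalSubset R) (hS : IsRationalSubset S) :
    ∃ (X : Type) (_ : Finite X) (ev : X → G) (L M : Language X), L.IsRegular ∧ M.IsRegular ∧
      wordEval ev '' {w | w ∈ L} = R ∧ wordEval ev '' {w | w ∈ M} = S := by
  obtain ⟨X, hX, ev, L, hL, rfl⟩ := hR
  obtain ⟨Y, hY, ev', M, hM, rfl⟩ := hS
  refine ⟨X ⊕ Y, inferInstance, Sum.elim ev ev', _, _, isRegular_map hL Sum.inl,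
    isRegular_map hM Sum.inr, ?_, ?_⟩
  · exact (Set.image_image _ (List.map Sum.inl) {w | w ∈ L}).trans
      (Set.image_congr fun w _ ↦ wordEval_map _ _ w)
  · exact (Set.image_image _ (List.map Sum.inr) {w | w ∈ M}).trans
      (Set.image_congr fun w _ ↦ wordEval_map _ _ w)

theorem union (hR : IsRationalSubset R) (hS : IsRationalSubset S) :
    IsRationalSubset (R ∪ S) := by
  obtain ⟨X, hX, ev, L, M, hL, hM, rfl, rfl⟩ := hR.exists_common_alphabet hS
  exact ⟨X, hX, ev, L + M, hL.add hM, Set.image_union ..⟩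

theorem mul (hR : IsRationalSubset R) (hS : IsRationalSubset S) :
    IsRationalSubset (R * S) := by
  obtain ⟨X, hX, ev, L, M, hL, hM, rfl, rfl⟩ := hR.exists_common_alphabet hS
  exact ⟨X, hX, ev, L * M, isRegular_mul hL hM,
    Set.image_image2_distrib fun u v ↦ wordEval_append ev u v⟩

theorem submonoidClosure (hR : IsRationalSubset R) :
    IsRationalSubset (Submonoid.closure R : Set G) := by
  obtain ⟨X, hX, ev, L, hL, rfl⟩ := hR
  refine ⟨X, hX, ev, L∗, isRegular_kstar hL, Set.Subset.antisymm ?_ fun g hg ↦ ?_⟩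
  · rintro _ ⟨w, hw, rfl⟩
    obtain ⟨S, rfl, hS⟩ := Language.mem_kstar.1 hw
    rw [wordEval, List.map_flatten, List.prod_flatten]
    refine Submonoid.list_prod_mem _ fun g hg ↦ ?_
    simp only [List.map_map, List.mem_map, Function.comp_apply] at hg
    obtain ⟨y, hy, rfl⟩ := hg
    exact Submonoid.subset_closure ⟨y, hS y hy, rfl⟩
  · induction hg using Submonoid.closure_induction with
    | mem g hg =>
      obtain ⟨w, hw, rfl⟩ := hg
      exact ⟨w, (le_kstar : L ≤ L∗) hw, rfl⟩
    | one => exact ⟨[], Language.nil_mem_kstar L, rfl⟩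
    | mul x y _ _ hx hy =>
      obtain ⟨u, hu, rfl⟩ := hx
      obtain ⟨v, hv, rfl⟩ := hy
      exact ⟨u ++ v, kstar_mul_kstar L ▸ Language.append_mem_mul hu hv, wordEval_append ev u v⟩

theorem powers (g : G) : IsRationalSubset (Submonoid.powers g : Set G) := by
  rw [Submonoid.powers_eq_closure]
  exact (singleton g).submonoidClosure

end IsRationalSubset

/-! ### Left-orders -/

namespace IsLeftOrder

variable {G : Type u} [Group G] {lt : G → G → Prop}

theorem of_subsemigroups {P N : Subsemigroup G} (hP : 1 ∉ P) (hN : 1 ∉ N)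
    (hcover : ∀ g, g ∈ P ∨ g = 1 ∨ g ∈ N) : IsLeftOrder G fun a b ↦ a⁻¹ * b ∈ P where
  strictTotal :=
    { irrefl := fun a ha ↦ hP (by simpa using ha)
      trans := fun a b c hab hbc ↦ by simpa [mul_assoc] using mul_mem hab hbc
      trichotomous := fun a b hab hba ↦ by
        rcases hcover (a⁻¹ * b) with h | h | hab'
        · exact absurd h hab
        · exact inv_mul_eq_one.1 h
        rcases hcover (b⁻¹ * a) with h | h | hba'
        · exact absurd h hba
        · exact (inv_mul_eq_one.1 h).symm
        · exact absurd (by simpa [mul_assoc] using mul_mem hab' hba') hN }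
  mul_left_iff a b c := by simp [mul_assoc]

theorem comap {H : Type v} [Group H] (h : IsLeftOrder G lt) {f : H →* G}
    (hf : Function.Injective f) : IsLeftOrder H fun a b ↦ lt (f a) (f b) where
  strictTotal :=
    have := h.strictTotal
    (RelEmbedding.preimage ⟨f, hf⟩ lt).isStrictTotalOrder
  mul_left_iff a b c := by simp only [map_mul, h.mul_left_iff]

theorem inv_mul_mem_positiveCone_iff (h : IsLeftOrder G lt) {a b : G} :
    a⁻¹ * b ∈ positiveCone lt ↔ lt a b := by
  rw [positiveCone, Set.mem_ofPred_eq, ← h.mul_left_iff 1 (a⁻¹ * b) a, mul_one,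
    mul_inv_cancel_left]

theorem one_notMem_positiveCone (h : IsLeftOrder G lt) : 1 ∉ positiveCone lt :=
  have := h.strictTotal
  irrefl_of lt 1

theorem mul_mem_positiveCone (h : IsLeftOrder G lt) {a b : G} (ha : a ∈ positiveCone lt)
    (hb : b ∈ positiveCone lt) : a * b ∈ positiveCone lt :=
  have := h.strictTotal
  trans_of lt ha (by simpa using (h.mul_left_iff 1 b a).2 hb)

theorem mem_positiveCone_trichotomy (h : IsLeftOrder G lt) (a : G) :
    a ∈ positiveCone lt ∨ a = 1 ∨ a⁻¹ ∈ positiveCone lt := by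
  have := h.strictTotal
  rw [← mul_one a⁻¹, h.inv_mul_mem_positiveCone_iff, eq_comm]
  exact trichotomous_of lt 1 a

/- The language of the positive cone need not use enough letters to generate `G` as a monoid;
adding the inverses of its letters to the alphabet makes up for that. -/
theorem isRegularLeftOrder (h : IsLeftOrder G lt) (hR : IsRationalSubset (positiveCone lt)) :
    IsRegularLeftOrder G lt := by
  obtain ⟨X, hX, ev, L, M, hL, -, hLP, hMP⟩ := hR.exists_common_alphabet hR.inv
  refine ⟨h, X, hX, ev, fun g ↦ ?_, L, hL, hLP⟩
  rcases h.mem_positiveCone_trichotomy g with hg | rfl | hg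
  · obtain ⟨w, -, hw⟩ := hLP.symm.subset hg
    exact ⟨w, hw⟩
  · exact ⟨[], rfl⟩
  · obtain ⟨w, -, hw⟩ := hMP.symm.subset hg
    exact ⟨w, hw⟩

end IsLeftOrder

theorem IsRegularLeftOrder.isRationalSubset {G : Type u} [Group G] {lt : G → G → Prop}
    (h : IsRegularLeftOrder G lt) : IsRationalSubset (positiveCone lt) := by
  obtain ⟨X, hX, ev, -, L, hL, hLP⟩ := h.exists_language
  exact ⟨X, hX, ev, L, hL, hLP⟩

theorem AdmitsRegularLeftOrder.of_mulEquiv {G : Type u} {H : Type v} [Group G] [Group H]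
    (h : AdmitsRegularLeftOrder G) (e : G ≃* H) : AdmitsRegularLeftOrder H := by
  obtain ⟨lt, hlt⟩ := h
  refine ⟨_, (hlt.isLeftOrder.comap (f := (e.symm : H →* G))
    e.symm.injective).isRegularLeftOrder ?_⟩
  convert hlt.isRationalSubset.image (e : G →* H) using 1
  ext x
  simpa [positiveCone] using (e.toEquiv.exists_congr_left (p := fun y ↦ lt 1 y ∧ e y = x)).symm

/-! ### Alternating products -/

section AlternatingProducts

variable {H : Type u} [Group H]

/-- `S` is closed under multiplication up to dropping a factor `w`, as is the open interval
between `1` and a central element `w` of a left-ordered group. -/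
def IsMulClosedUpTo (S : Set H) (w : H) : Prop :=
  ∀ x ∈ S, ∀ y ∈ S, x * y = w ∨ x * y ∈ S ∨ ∃ u ∈ S, x * y = u * w

/-- Nonempty products whose factors lie alternately in `s true` and `s false`, the first one in
`s i`. -/
inductive IsAlternating (s : Bool → Set H) : Bool → H → Prop
  | single {i : Bool} {x : H} : x ∈ s i → IsAlternating s i x
  | cons {i : Bool} {x y : H} : x ∈ s i → IsAlternating s (!i) y → IsAlternating s i (x * y)

namespace IsAlternating

variable {s : Bool → Set H} {i : Bool} {x y w : H}

theorem map {K : Type v} [Group K] {t : Bool → Set K} {f : H →* K}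
    (hst : ∀ i, Set.MapsTo f (s i) (t i)) (hx : IsAlternating s i x) :
    IsAlternating t i (f x) := by
  induction hx with
  | single hx => exact .single (hst _ hx)
  | cons hx _ ih => exact map_mul f _ _ ▸ .cons (hst _ hx) ih

theorem swap (hx : IsAlternating s i x) : IsAlternating (fun j ↦ s !j) (!i) x := by
  induction hx with
  | single hx => exact .single (by simpa using hx)
  | cons hx _ ih => exact .cons (by simpa using hx) ih

theorem letter_mul (hs : IsMulClosedUpTo (s i) w) (hw : ∀ h, Commute w h) (hx : x ∈ s i)
    (hy : IsAlternating s i y) :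
    x * y = w ∨ (∃ r, IsAlternating s (!i) r ∧ x * y = r * w) ∨ IsAlternating s i (x * y) ∨
      ∃ u, IsAlternating s i u ∧ x * y = u * w := by
  cases hy with
  | single hy =>
    rcases hs x hx y hy with h | h | ⟨u, hu, h⟩
    · exact .inl h
    · exact .inr (.inr (.inl (.single h)))
    · exact .inr (.inr (.inr ⟨u, .single hu, h⟩))
  | @cons _ y r hy hr =>
    rw [← mul_assoc]
    rcases hs x hx y hy with h | h | ⟨u, hu, h⟩
    · exact .inr (.inl ⟨r, hr, by rw [h, (hw r).eq]⟩)
    · exact .inr (.inr (.inl (.cons h hr)))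
    · exact .inr (.inr (.inr ⟨u * r, .cons hu hr, by rw [h, mul_assoc, (hw r).eq, mul_assoc]⟩))

theorem setOf_eq (s : Bool → Set H) (i : Bool) :
    {x | IsAlternating s i x} =
      (Submonoid.closure (s i * s !i) : Set H) * (s i ∪ s i * s !i) := by
  set R : Bool → Set H := fun i ↦ (Submonoid.closure (s i * s !i) : Set H) * (s i ∪ s i * s !i)
  refine Set.Subset.antisymm (fun x hx ↦ ?_) ?_
  · suffices h : x ∈ R i ∧ ∀ y ∈ s !i, y * x ∈ R !i from h.1
    induction hx with
    | @single i x hx =>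
      refine ⟨⟨1, one_mem _, x, .inl hx, one_mul x⟩, fun y hy ↦ ?_⟩
      exact ⟨1, one_mem _, y * x, .inr (Set.mul_mem_mul hy (by simpa using hx)), one_mul _⟩
    | @cons i x y hx _ ih =>
      obtain ⟨⟨p, hp, q, hq, rfl⟩, hmul⟩ := ih
      refine ⟨by simpa using hmul x (by simpa using hx), fun u hu ↦ ?_⟩
      have hux : u * x ∈ Submonoid.closure (s (!i) * s !!i) :=
        Submonoid.subset_closure (Set.mul_mem_mul hu (by simpa using hx))
      exact ⟨u * x * p, mul_mem hux hp, q, hq, by simp only [mul_assoc]⟩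
  · rintro _ ⟨p, hp, q, hq, rfl⟩
    have hq' : IsAlternating s i q := by
      rcases hq with hq | ⟨u, hu, v, hv, rfl⟩
      · exact .single hq
      · exact .cons hu (.single hv)
    change IsAlternating s i (p * q)
    induction hp using Submonoid.closure_induction_left with
    | one => rwa [one_mul]
    | mul_left uv huv p _ ih =>
      obtain ⟨u, hu, v, hv, rfl⟩ := huv
      simpa only [mul_assoc] using cons hu (cons hv (by simpa using ih))

theorem isRationalSubset (hs : ∀ i, IsRationalSubset (s i)) (i : Bool) :
    IsRationalSubset {x | IsAlternating s i x} := by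
  rw [setOf_eq]
  have hpair : IsRationalSubset (s i * s !i) := (hs i).mul (hs !i)
  exact hpair.submonoidClosure.mul ((hs i).union hpair)

end IsAlternating

/-- The union over `k` of the products `x * z ^ k` with `x` alternating and starting in `s true`
for `0 ≤ k`, and with `x` equal to `1` or alternating and starting in `s false` for `m ≤ k`.
For `m = 1` this is the positive cone of a left-order; `m = 0` adds `1` and the alternating
products starting in `s false`. -/
inductive AlternatingCone (s : Bool → Set H) (z : H) (m : ℕ) : H → Prop
  | pow {k : ℕ} : m ≤ k → AlternatingCone s z m (z ^ k)
  | mul_pow_true {x : H} (k : ℕ) : IsAlternating s true x → AlternatingCone s z m (x * z ^ k)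
  | mul_pow_false {x : H} {k : ℕ} :
      IsAlternating s false x → m ≤ k → AlternatingCone s z m (x * z ^ k)

/-- The multiplication rules of the letters of an alternating product: products of letters from
`s true` are reduced by the central element `z`, those of letters from `s false` by `z⁻¹`. -/
structure IsTwistedPair (s : Bool → Set H) (z : H) : Prop where
  central (h : H) : Commute z h
  mul (i : Bool) : IsMulClosedUpTo (s i) (bif i then z else z⁻¹)

theorem IsTwistedPair.swap {s : Bool → Set H} {z : H} (h : IsTwistedPair s z) :
    IsTwistedPair (fun j ↦ s !j) z⁻¹ where
  central g := (h.central g).inv_left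
  mul
    | true => h.mul false
    | false => (inv_inv z).symm ▸ h.mul true

namespace AlternatingCone

variable {s : Bool → Set H} {z x y : H} {m n : ℕ}

theorem setOf_eq (s : Bool → Set H) (z : H) (m : ℕ) :
    {x | AlternatingCone s z m x} = {z ^ m} * (Submonoid.powers z : Set H) ∪
      {x | IsAlternating s true x} * (Submonoid.powers z : Set H) ∪
      {x | IsAlternating s false x} * ({z ^ m} * (Submonoid.powers z : Set H)) := by
  have hpow (x : H) : x ∈ ({z ^ m} : Set H) * (Submonoid.powers z : Set H) ↔
      ∃ k, m ≤ k ∧ z ^ k = x := by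
    simp only [Set.singleton_mul, Set.mem_image, SetLike.mem_coe, Submonoid.mem_powers_iff,
      exists_exists_eq_and, ← pow_add, le_iff_exists_add]
    exact ⟨fun ⟨j, hj⟩ ↦ ⟨_, ⟨j, rfl⟩, hj⟩, fun ⟨_, ⟨j, rfl⟩, hj⟩ ↦ ⟨j, hj⟩⟩
  ext x
  constructor
  · rintro (hk | ⟨k, hx⟩ | ⟨hx, hk⟩)
    · exact .inl (.inl ((hpow _).2 ⟨_, hk, rfl⟩))
    · exact .inl (.inr (Set.mul_mem_mul hx ⟨k, rfl⟩))
    · exact .inr (Set.mul_mem_mul hx ((hpow _).2 ⟨_, hk, rfl⟩))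
  · rintro ((hx | ⟨x, hx, _, ⟨k, rfl⟩, rfl⟩) | ⟨x, hx, p, hp, rfl⟩)
    · obtain ⟨k, hk, rfl⟩ := (hpow _).1 hx
      exact pow hk
    · exact mul_pow_true k hx
    · obtain ⟨k, hk, rfl⟩ := (hpow _).1 hp
      exact mul_pow_false hx hk

theorem isRationalSubset (hs : ∀ i, IsRationalSubset (s i)) (z : H) (m : ℕ) :
    IsRationalSubset {x | AlternatingCone s z m x} := by
  rw [setOf_eq]
  have hpow : IsRationalSubset ({z ^ m} * (Submonoid.powers z : Set H)) :=
    (IsRationalSubset.singleton _).mul (.powers z)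
  exact (hpow.union ((IsAlternating.isRationalSubset hs true).mul (.powers z))).union
    ((IsAlternating.isRationalSubset hs false).mul hpow)

theorem of_isAlternating_true (hx : IsAlternating s true x) : AlternatingCone s z m x := by
  simpa using mul_pow_true 0 hx

theorem mono (hx : AlternatingCone s z n x) (hmn : m ≤ n) : AlternatingCone s z m x := by
  cases hx with
  | pow hk => exact pow (hmn.trans hk)
  | mul_pow_true k hx => exact mul_pow_true k hx
  | mul_pow_false hx hk => exact mul_pow_false hx (hmn.trans hk)

theorem mul_pow (hx : AlternatingCone s z m x) (k : ℕ) :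
    AlternatingCone s z (m + k) (x * z ^ k) := by
  cases hx with
  | pow hk => exact pow_add z _ k ▸ pow (by gcongr)
  | mul_pow_true j hx => exact mul_assoc _ (z ^ j) _ ▸ pow_add z j k ▸ mul_pow_true _ hx
  | @mul_pow_false _ j hx hk =>
    exact mul_assoc _ (z ^ j) _ ▸ pow_add z j k ▸ mul_pow_false hx (by gcongr)

theorem letter_true_mul (h : IsTwistedPair s z) (hx : x ∈ s true) (hy : AlternatingCone s z 0 y) :
    AlternatingCone s z 1 (x * y) := by
  cases hy with
  | pow _ => exact mul_pow_true _ (.single hx)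
  | @mul_pow_true y k hy =>
    rw [← mul_assoc]
    rcases IsAlternating.letter_mul (h.mul true) h.central hx hy with
      hxy | ⟨r, hr, hxy⟩ | hxy | ⟨u, hu, hxy⟩
    · rw [hxy, cond_true, ← pow_succ']
      exact pow k.succ_pos
    · rw [hxy, mul_assoc, cond_true, ← pow_succ']
      exact mul_pow_false hr k.succ_pos
    · exact mul_pow_true k hxy
    · rw [hxy, mul_assoc, cond_true, ← pow_succ']
      exact mul_pow_true _ hu
  | mul_pow_false hy _ =>
    rw [← mul_assoc]
    exact mul_pow_true _ (.cons hx hy)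

theorem letter_false_mul (h : IsTwistedPair s z) (hx : x ∈ s false)
    (hy : AlternatingCone s z 1 y) : AlternatingCone s z 0 (x * y) := by
  cases hy with
  | pow _ => exact mul_pow_false (.single hx) (Nat.zero_le _)
  | mul_pow_true _ hy =>
    rw [← mul_assoc]
    exact mul_pow_false (.cons hx hy) (Nat.zero_le _)
  | @mul_pow_false y k hy hk =>
    obtain ⟨k, rfl⟩ := Nat.exists_eq_add_of_le' hk
    have hz : z⁻¹ * z ^ (k + 1) = z ^ k := by rw [pow_succ', inv_mul_cancel_left]
    rw [← mul_assoc]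
    rcases IsAlternating.letter_mul (h.mul false) (fun g ↦ (h.central g).inv_left) hx hy with
      hxy | ⟨r, hr, hxy⟩ | hxy | ⟨u, hu, hxy⟩
    · rw [hxy, cond_false, hz]
      exact pow k.zero_le
    · rw [hxy, mul_assoc, cond_false, hz]
      exact mul_pow_true k hr
    · exact mul_pow_false hxy (Nat.zero_le _)
    · rw [hxy, mul_assoc, cond_false, hz]
      exact mul_pow_false hu k.zero_le

theorem isAlternating_mul (h : IsTwistedPair s z) {i : Bool} (hx : IsAlternating s i x)
    (hy : AlternatingCone s z 1 y) : AlternatingCone s z (bif i then 1 else 0) (x * y) := by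
  induction hx with
  | @single i x hx =>
    cases i with
    | true => exact letter_true_mul h hx (hy.mono zero_le_one)
    | false => exact letter_false_mul h hx hy
  | @cons i x x' hx _ ih =>
    rw [mul_assoc]
    cases i with
    | true => exact letter_true_mul h hx ih
    | false => exact letter_false_mul h hx ih

protected theorem mul (h : IsTwistedPair s z) (hx : AlternatingCone s z 1 x)
    (hy : AlternatingCone s z 1 y) : AlternatingCone s z 1 (x * y) := by
  have hcomm (k : ℕ) : z ^ k * y = y * z ^ k := ((h.central y).pow_left k).eq
  cases hx with
  | @pow k hk =>
    rw [hcomm]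
    exact (hy.mul_pow k).mono (by lia)
  | @mul_pow_true x k hx =>
    rw [mul_assoc, hcomm, ← mul_assoc]
    exact ((isAlternating_mul h hx hy).mul_pow k).mono (Nat.le_add_right 1 k)
  | @mul_pow_false x k hx hk =>
    rw [mul_assoc, hcomm, ← mul_assoc]
    exact ((isAlternating_mul h hx hy).mul_pow k).mono (hk.trans_eq k.zero_add.symm)

theorem ne_one (hz : ¬ IsOfFinOrder z)
    (hs : ∀ i x, IsAlternating s i x → x ∉ Subgroup.zpowers z) (hx : AlternatingCone s z 1 x) :
    x ≠ 1 := by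
  rintro hx1
  cases hx with
  | pow hk => exact hz (isOfFinOrder_iff_pow_eq_one.2 ⟨_, hk, hx1⟩)
  | mul_pow_true k hx =>
    exact hs _ _ hx (eq_inv_of_mul_eq_one_left hx1 ▸ inv_mem (Subgroup.npow_mem_zpowers z k))
  | @mul_pow_false x k hx _ =>
    exact hs _ _ hx (eq_inv_of_mul_eq_one_left hx1 ▸ inv_mem (Subgroup.npow_mem_zpowers z k))

theorem isAlternating_mul_pow {i : Bool} (hx : IsAlternating s i x) {k : ℕ} (hk : m ≤ k) :
    AlternatingCone s z m (x * z ^ k) := by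
  cases i with
  | true => exact mul_pow_true k hx
  | false => exact mul_pow_false hx hk

theorem or_eq_one_or (hx : ∃ k : ℤ, x = z ^ k ∨ ∃ i y, IsAlternating s i y ∧ x = y * z ^ k) :
    AlternatingCone s z 1 x ∨ x = 1 ∨ AlternatingCone (fun j ↦ s !j) z⁻¹ 1 x := by
  obtain ⟨k, hx⟩ := hx
  obtain ⟨n, rfl | rfl⟩ := k.eq_nat_or_neg <;>
    simp only [zpow_neg, zpow_natCast, ← inv_pow] at hx <;>
    obtain rfl | hn := n.eq_zero_or_pos <;>
    obtain rfl | ⟨i, y, hy, rfl⟩ := hx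
  case inl.inr.inl => exact .inl (pow hn)
  case inl.inr.inr => exact .inl (isAlternating_mul_pow hy hn)
  case inr.inr.inl => exact .inr (.inr (pow hn))
  case inr.inr.inr => exact .inr (.inr (isAlternating_mul_pow hy.swap hn))
  case inl.inl.inl | inr.inl.inl => exact .inr (.inl (pow_zero _))
  case inl.inl.inr | inr.inl.inr =>
    rw [pow_zero, mul_one]
    cases i with
    | true => exact .inl (of_isAlternating_true hy)
    | false => exact .inr (.inr (of_isAlternating_true hy.swap))

/-- The semigroup of the elements of an alternating cone, for a twisted pair. -/
def subsemigroup (h : IsTwistedPair s z) : Subsemigroup H where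
  carrier := {x | AlternatingCone s z 1 x}
  mul_mem' := AlternatingCone.mul h

end AlternatingCone

theorem IsTwistedPair.admitsRegularLeftOrder {s : Bool → Set H} {z : H} (h : IsTwistedPair s z)
    (hrat : ∀ i, IsRationalSubset (s i)) (hz : ¬ IsOfFinOrder z)
    (hs : ∀ i x, IsAlternating s i x → x ∉ Subgroup.zpowers z)
    (hcover : ∀ x, ∃ k : ℤ, x = z ^ k ∨ ∃ i y, IsAlternating s i y ∧ x = y * z ^ k) :
    AdmitsRegularLeftOrder H := by
  have hP : 1 ∉ AlternatingCone.subsemigroup h := fun h1 ↦ h1.ne_one hz hs rfl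
  have hN : 1 ∉ AlternatingCone.subsemigroup h.swap := fun h1 ↦
    h1.ne_one (isOfFinOrder_inv_iff.not.2 hz) (fun i x hx ↦ by
      simpa using hs _ x (by simpa using hx.swap)) rfl
  have horder := IsLeftOrder.of_subsemigroups hP hN fun x ↦
    AlternatingCone.or_eq_one_or (hcover x)
  refine ⟨_, horder.isRegularLeftOrder ?_⟩
  convert AlternatingCone.isRationalSubset hrat z 1 using 1
  ext x
  simp [positiveCone, AlternatingCone.subsemigroup]

end AlternatingProducts

/-! ### Intervals of letters -/

section LetterInterval

variable {F : Type u} {H : Type v} [Group F] [Group H]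

/-- The elements `f a` with `1 < a` and `f a * z` with `a < 1`. For the inclusion `f` of `F` into
`F × ℤ`, ordered lexicographically with `ℤ` leading, this is the open interval between `1` and the
generator `z` of `ℤ`. -/
def letterInterval (lt : F → F → Prop) (f : F →* H) (z : H) : Set H :=
  f '' positiveCone lt ∪ f '' (positiveCone lt)⁻¹ * {z}

variable {lt : F → F → Prop}

theorem isRationalSubset_letterInterval (h : IsRationalSubset (positiveCone lt)) (f : F →* H)
    (z : H) : IsRationalSubset (letterInterval lt f z) :=
  (h.image f).union ((h.inv.image f).mul (.singleton z))

theorem exists_mul_pow_mem_letterInterval (h : IsLeftOrder F lt) (f : F →* H) (z : H) {a : F}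
    (ha : a ≠ 1) : ∃ k : ℕ, f a * z ^ k ∈ letterInterval lt f z := by
  rcases h.mem_positiveCone_trichotomy a with ha' | rfl | ha'
  · exact ⟨0, .inl ⟨a, ha', by simp⟩⟩
  · exact absurd rfl ha
  · exact ⟨1, .inr ⟨f a, ⟨a, ha', rfl⟩, z, rfl, by simp⟩⟩

theorem exists_of_mem_letterInterval (h : IsLeftOrder F lt) {f : F →* H} {z x : H}
    (hx : x ∈ letterInterval lt f z) : ∃ a ≠ 1, ∃ k : ℕ, x = f a * z ^ k := by
  have hne {a : F} (ha : a ∈ positiveCone lt) : a ≠ 1 :=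
    fun ha1 ↦ h.one_notMem_positiveCone (ha1 ▸ ha)
  obtain ⟨a, ha, rfl⟩ | ⟨_, ⟨a, ha, rfl⟩, _, rfl, rfl⟩ := hx
  · exact ⟨a, hne ha, 0, by simp⟩
  · exact ⟨a, inv_ne_one.1 (hne ha), 1, by simp⟩

theorem isMulClosedUpTo_letterInterval (h : IsLeftOrder F lt) (f : F →* H) {z : H}
    (hz : ∀ x, Commute z x) : IsMulClosedUpTo (letterInterval lt f z) z := by
  have pos {a : F} (ha : a ∈ positiveCone lt) : f a ∈ letterInterval lt f z := .inl ⟨a, ha, rfl⟩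
  have neg {a : F} (ha : a⁻¹ ∈ positiveCone lt) : f a * z ∈ letterInterval lt f z :=
    .inr (Set.mul_mem_mul ⟨a, ha, rfl⟩ rfl)
  have mixed (a : F) : f a * z = z ∨ f a * z ∈ letterInterval lt f z ∨
      ∃ u ∈ letterInterval lt f z, f a * z = u * z := by
    rcases h.mem_positiveCone_trichotomy a with ha | rfl | ha
    · exact .inr (.inr ⟨f a, pos ha, rfl⟩)
    · exact .inl (by simp)
    · exact .inr (.inl (neg ha))
  rintro _ (⟨a, ha, rfl⟩ | ⟨_, ⟨a, ha, rfl⟩, z, rfl, rfl⟩)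
    _ (⟨b, hb, rfl⟩ | ⟨_, ⟨b, hb, rfl⟩, z, rfl, rfl⟩)
  · exact .inr (.inl (map_mul f a b ▸ pos (h.mul_mem_positiveCone ha hb)))
  · simpa only [map_mul, mul_assoc] using mixed (a * b)
  · simpa only [map_mul, mul_assoc, (hz (f b)).eq] using mixed (a * b)
  · have hab : (a * b)⁻¹ ∈ positiveCone lt := by
      simpa only [mul_inv_rev] using h.mul_mem_positiveCone hb ha
    refine .inr (.inr ⟨f (a * b) * z, neg hab, ?_⟩)
    simp only [map_mul, mul_assoc, (hz (f b * z)).eq]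

end LetterInterval

/-! ### Reduced forms in free products -/

section ReducedForm

variable {ι : Type u} {G : ι → Type v} [∀ i, Group (G i)]

open scoped Classical in
/-- The index of the first factor of the reduced form of an element of a free product, `none` for
the identity. -/
noncomputable def leadingIndex (x : CoprodI G) : Option ι :=
  (CoprodI.Word.equiv x).fstIdx

theorem leadingIndex_prod (w : CoprodI.Word G) : leadingIndex w.prod = w.fstIdx := by
  classical
  exact congrArg CoprodI.Word.fstIdx (CoprodI.Word.equiv.apply_symm_apply w)

theorem exists_word_prod_eq (x : CoprodI G) : ∃ w : CoprodI.Word G, w.prod = x := by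
  classical
  exact CoprodI.Word.equiv.symm.surjective x

theorem leadingIndex_one : leadingIndex (1 : CoprodI G) = none :=
  leadingIndex_prod .empty

theorem leadingIndex_of_mul {i : ι} {m : G i} {x : CoprodI G} (hm : m ≠ 1)
    (hx : leadingIndex x ≠ some i) : leadingIndex (CoprodI.of m * x) = some i := by
  obtain ⟨w, rfl⟩ := exists_word_prod_eq x
  rw [leadingIndex_prod] at hx
  rw [← CoprodI.Word.prod_cons i m w hm hx, leadingIndex_prod, CoprodI.Word.fstIdx_cons]

theorem leadingIndex_of {i : ι} {m : G i} (hm : m ≠ 1) : leadingIndex (CoprodI.of m) = some i := by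
  simpa using leadingIndex_of_mul hm (x := 1) (by simp [leadingIndex_one])

theorem reduced_induction {p : CoprodI G → Prop} (one : p 1)
    (of_mul : ∀ {i} (m : G i) (x : CoprodI G), m ≠ 1 → leadingIndex x ≠ some i → p x →
      p (CoprodI.of m * x)) (x : CoprodI G) : p x := by
  obtain ⟨w, rfl⟩ := exists_word_prod_eq x
  induction w using CoprodI.Word.consRecOn with
  | empty => simpa using one
  | cons i m w hw hm ih =>
    rw [CoprodI.Word.prod_cons]
    exact of_mul m _ hm (leadingIndex_prod w ▸ hw) ih

theorem mul_of_eq_one_or_leadingIndex_eq {i : ι} (m : G i) (x : CoprodI G) :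
    x = 1 ∨ x * CoprodI.of m = 1 ∨ leadingIndex (x * CoprodI.of m) = leadingIndex x := by
  induction x using reduced_induction with
  | one => exact .inl rfl
  | @of_mul j n x hn hx ih =>
    rw [leadingIndex_of_mul hn hx, mul_assoc]
    rcases ih with rfl | hxm | hxm
    · rw [mul_one, one_mul]
      obtain rfl | hij := eq_or_ne i j
      · rw [← map_mul]
        obtain hnm | hnm := eq_or_ne (n * m) 1
        · exact .inr (.inl (by rw [hnm, map_one]))
        · exact .inr (.inr (leadingIndex_of hnm))
      obtain rfl | hm := eq_or_ne m 1
      · exact .inr (.inr (by rw [map_one, mul_one, leadingIndex_of hn]))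
      · refine .inr (.inr (leadingIndex_of_mul hn ?_))
        simpa [leadingIndex_of hm] using hij
    · exact .inr (.inr (by rw [hxm, mul_one, leadingIndex_of hn]))
    · exact .inr (.inr (leadingIndex_of_mul hn (hxm ▸ hx)))

theorem finite_setOf_leadingIndex_mul_ne (y : CoprodI G) :
    {x : CoprodI G | leadingIndex (x * y) ≠ leadingIndex x}.Finite := by
  induction y using CoprodI.induction_on with
  | one => simp
  | of i m =>
    refine (Set.toFinite {1, (CoprodI.of m)⁻¹}).subset fun x hx ↦ ?_
    rcases mul_of_eq_one_or_leadingIndex_eq m x with h | h | h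
    · exact .inl h
    · exact .inr (eq_inv_of_mul_eq_one_left h)
    · exact absurd h hx
  | mul y z hy hz =>
    refine (hy.union (hz.preimage (mul_left_injective y).injOn)).subset fun x hx ↦ ?_
    by_contra! h
    simp_all [mul_assoc]

end ReducedForm

section TwoFactors

variable {F : Bool → Type u} [∀ i, Group (F i)]

theorem IsAlternating.leadingIndex_eq {i : Bool} {x : CoprodI F}
    (hx : IsAlternating (fun i ↦ CoprodI.of '' {m : F i | m ≠ 1}) i x) :
    leadingIndex x = some i := by
  induction hx with
  | single hx =>
    obtain ⟨m, hm, rfl⟩ := hx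
    exact leadingIndex_of hm
  | cons hx _ ih =>
    obtain ⟨m, hm, rfl⟩ := hx
    exact leadingIndex_of_mul hm (by simp [ih])

theorem exists_isAlternating_of_surjOn {H : Type v} [Group H] {f : H →* CoprodI F}
    {s : Bool → Set H} (hs : ∀ i, Set.SurjOn f (s i) (CoprodI.of '' {m : F i | m ≠ 1}))
    (g : CoprodI F) :
    g = 1 ∨ ∃ i x, leadingIndex g = some i ∧ IsAlternating s i x ∧ f x = g := by
  induction g using reduced_induction with
  | one => exact .inl rfl
  | @of_mul i m g hm hg ih =>
    obtain ⟨x, hx, hxm⟩ := hs i ⟨m, hm, rfl⟩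
    refine .inr ⟨i, ?_⟩
    obtain rfl | ⟨j, y, hj, hy, rfl⟩ := ih
    · exact ⟨x, leadingIndex_of_mul hm hg, .single hx, by rw [hxm, mul_one]⟩
    · obtain rfl : j = !i := by simpa [hj, Bool.eq_not] using hg
      exact ⟨x * y, leadingIndex_of_mul hm hg, .cons hx hy, by rw [map_mul, hxm]⟩

theorem commute_one_mk {M N : Type*} [Monoid M] [CommMonoid N] (n : N) (x : M × N) :
    Commute (1, n) x :=
  Prod.ext ((one_mul x.1).trans (mul_one x.1).symm) (mul_comm n x.2)

theorem zpow_one_mk_ofAdd {M : Type*} [Group M] (k : ℤ) :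
    ((1, .ofAdd 1) : M × Multiplicative ℤ) ^ k = (1, .ofAdd k) := by
  simp [← ofAdd_zsmul]

/-- The letters of the factor `F i` in `CoprodI F × ℤ`: the interval between `1` and the generator
of `ℤ` for `i = true`, between `1` and its inverse for `i = false`. -/
def freeProductLetters (lt : ∀ i, F i → F i → Prop) (i : Bool) :
    Set (CoprodI F × Multiplicative ℤ) :=
  letterInterval (lt i) ((MonoidHom.inl _ _).comp CoprodI.of)
    (bif i then (1, .ofAdd 1) else (1, .ofAdd 1)⁻¹)

theorem isTwistedPair_freeProductLetters {lt : ∀ i, F i → F i → Prop}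
    (h : ∀ i, IsLeftOrder (F i) (lt i)) :
    IsTwistedPair (freeProductLetters lt) (1, .ofAdd 1) where
  central := commute_one_mk _
  mul i := isMulClosedUpTo_letterInterval (h i) _ fun x ↦ by
    cases i with
    | true => exact commute_one_mk _ x
    | false => exact (commute_one_mk _ x).inv_left

theorem surjOn_fst_freeProductLetters {lt : ∀ i, F i → F i → Prop} {i : Bool}
    (h : IsLeftOrder (F i) (lt i)) :
    Set.SurjOn (MonoidHom.fst _ _) (freeProductLetters lt i) (CoprodI.of '' {m : F i | m ≠ 1}) := by
  rintro _ ⟨m, hm, rfl⟩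
  obtain ⟨k, hk⟩ : ∃ k : ℕ, _ ∈ freeProductLetters lt i :=
    exists_mul_pow_mem_letterInterval h _ _ hm
  exact ⟨_, hk, by cases i <;> simp⟩

theorem mapsTo_fst_freeProductLetters {lt : ∀ i, F i → F i → Prop} {i : Bool}
    (h : IsLeftOrder (F i) (lt i)) :
    Set.MapsTo (MonoidHom.fst _ _) (freeProductLetters lt i) (CoprodI.of '' {m : F i | m ≠ 1}) := by
  intro x hx
  obtain ⟨m, hm, k, rfl⟩ := exists_of_mem_letterInterval h hx
  exact ⟨m, hm, by cases i <;> simp⟩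

theorem admitsRegularLeftOrder_coprodI_prod_int (h : ∀ i, AdmitsRegularLeftOrder (F i)) :
    AdmitsRegularLeftOrder (CoprodI F × Multiplicative ℤ) := by
  choose lt hlt using h
  have hlt' (i : Bool) : IsLeftOrder (F i) (lt i) := (hlt i).isLeftOrder
  refine (isTwistedPair_freeProductLetters hlt').admitsRegularLeftOrder
    (fun i ↦ isRationalSubset_letterInterval (hlt i).isRationalSubset _ _) ?_
    (fun i x hx hxz ↦ ?_) fun ⟨g, t⟩ ↦ ?_
  · rw [← injective_zpow_iff_not_isOfFinOrder]
    intro k l hkl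
    simpa only [zpow_one_mk_ofAdd, Prod.mk.injEq, true_and, EmbeddingLike.apply_eq_iff_eq]
      using hkl
  · obtain ⟨k, rfl⟩ := hxz
    have hlead := (hx.map fun i ↦ mapsTo_fst_freeProductLetters (hlt' i)).leadingIndex_eq
    simp [leadingIndex_one] at hlead
  · rcases exists_isAlternating_of_surjOn (fun i ↦ surjOn_fst_freeProductLetters (hlt' i)) g with
      rfl | ⟨i, x, -, hx, rfl⟩
    · exact ⟨t.toAdd, .inl (by rw [zpow_one_mk_ofAdd, ofAdd_toAdd])⟩
    · refine ⟨(x.2⁻¹ * t).toAdd, .inr ⟨i, x, hx, ?_⟩⟩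
      rw [zpow_one_mk_ofAdd, ofAdd_toAdd]
      exact Prod.ext (mul_one x.1).symm (mul_inv_cancel_left x.2 t).symm

end TwoFactors

/-! ### Almost invariant sets obstruct regularity -/

theorem exists_crossing {G : Type u} [Group G] {X : Type v} (ev : X → G) {S : Set G} {w : List X}
    {g : G} (hg : g ∈ S) (hw : g * wordEval ev w ∉ S) :
    ∃ p x q, w = p ++ x :: q ∧ g * wordEval ev p ∈ S ∧ g * wordEval ev p * ev x ∉ S := by
  induction w generalizing g with
  | nil => exact absurd (by simpa [wordEval] using hg) hw
  | cons x w ih =>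
    by_cases hx : g * ev x ∈ S
    · rw [wordEval_cons, ← mul_assoc] at hw
      obtain ⟨p, y, q, rfl, hp, hy⟩ := ih hx hw
      rw [mul_assoc g, ← wordEval_cons] at hp hy
      exact ⟨x :: p, y, q, rfl, hp, hy⟩
    · exact ⟨[], x, w, rfl, by simpa [wordEval] using hg, by simpa [wordEval] using hx⟩

namespace IsLeftOrder

variable {G : Type u} [Group G] {lt : G → G → Prop}

theorem exists_gt [Nontrivial G] (h : IsLeftOrder G lt) (a : G) : ∃ b, lt a b := by
  obtain ⟨g, hg⟩ := exists_ne (1 : G)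
  rcases h.mem_positiveCone_trichotomy g with h1 | rfl | h1
  · exact ⟨a * g, h.inv_mul_mem_positiveCone_iff.1 (by simpa using h1)⟩
  · exact absurd rfl hg
  · exact ⟨a * g⁻¹, h.inv_mul_mem_positiveCone_iff.1 (by simpa using h1)⟩

theorem exists_forall_lt [Nontrivial G] (h : IsLeftOrder G lt) {T : Set G} (hT : T.Finite) :
    ∃ m, ∀ x ∈ T, lt x m := by
  classical
  have := h.strictTotal
  let _ : LinearOrder G := linearOrderOfSTO lt
  obtain ⟨b, hb⟩ := hT.bddAbove
  obtain ⟨m, hm⟩ := h.exists_gt b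
  exact ⟨m, fun x hx ↦ lt_of_le_of_lt (hb hx) hm⟩

theorem exists_mem_gt [Nontrivial G] (h : IsLeftOrder G lt) {S : Set G} {a : G}
    (ha : ∀ x ∉ S, a * x ∈ S) (m : G) : ∃ f ∈ S, lt m f := by
  obtain ⟨x, hx⟩ := h.exists_forall_lt (Set.toFinite {m, a⁻¹ * m})
  by_cases hxS : x ∈ S
  · exact ⟨x, hxS, hx m (.inl rfl)⟩
  · exact ⟨a * x, ha x hxS, by simpa using (h.mul_left_iff _ _ a).2 (hx (a⁻¹ * m) (.inr rfl))⟩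

end IsLeftOrder

/- A path from `f` to `t` spelled by a word of the language of the positive cone leaves `S` at one
of finitely many places, and the initial segment up to there is completed by one of finitely many
words to a word of that language. -/
theorem IsRegularLeftOrder.exists_forall_mem_lt {G : Type u} [Group G] [Nontrivial G]
    {lt : G → G → Prop} (h : IsRegularLeftOrder G lt) {S : Set G}
    (hS : ∀ y, {x | x ∈ S ∧ x * y ∉ S}.Finite) :
    ∃ m, ∀ f ∈ S, ∀ t ∉ S, lt f t → lt f m := by
  obtain ⟨X, hX, ev, -, L, hL, hLP⟩ := h.exists_language
  have horder := h.isLeftOrder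
  have := horder.strictTotal
  obtain ⟨C, hC, hcomplete⟩ := exists_finite_completions hL
  have hfinite : (Set.image2 (fun x c ↦ x * wordEval ev c)
      (⋃ y : X, {x | x ∈ S ∧ x * ev y ∉ S}) C).Finite :=
    (Set.finite_iUnion fun y ↦ hS (ev y)).image2 _ hC
  obtain ⟨m, hm⟩ := horder.exists_forall_lt hfinite
  refine ⟨m, fun f hf t ht hft ↦ ?_⟩
  obtain ⟨w, hw, hwt⟩ := hLP.symm.subset (horder.inv_mul_mem_positiveCone_iff.2 hft)
  obtain ⟨p, x, q, rfl, hp, hpx⟩ :=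
    exists_crossing ev hf (w := w) (by rwa [hwt, mul_inv_cancel_left])
  obtain ⟨c, hc, hpc⟩ := hcomplete p _ hw
  have hfpc : lt f (f * wordEval ev p * wordEval ev c) := by
    rw [← horder.inv_mul_mem_positiveCone_iff, mul_assoc, inv_mul_cancel_left,
      ← wordEval_append]
    exact hLP.subset ⟨_, hpc, rfl⟩
  exact trans_of lt hfpc (hm _ ⟨_, Set.mem_iUnion.2 ⟨x, hp, hpx⟩, c, hc, rfl⟩)

theorem not_admitsRegularLeftOrder_of_almostInvariant {G : Type u} [Group G] [Nontrivial G]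
    {S : Set G} (hS : ∀ y, {x | x ∈ S ∧ x * y ∉ S}.Finite) {a b : G} (ha : ∀ x ∉ S, a * x ∈ S)
    (hb : ∀ x ∈ S, b * x ∉ S) : ¬ AdmitsRegularLeftOrder G := by
  rintro ⟨lt, h⟩
  have horder := h.isLeftOrder
  have := horder.strictTotal
  obtain ⟨m, hm⟩ := h.exists_forall_mem_lt hS
  obtain ⟨f, hf, hmf⟩ := horder.exists_mem_gt ha m
  obtain ⟨t, ht, hft⟩ := horder.exists_mem_gt (S := Sᶜ) (fun x hx ↦ hb x (not_not.1 hx)) f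
  exact asymm_of lt hmf (hm f hf t ht hft)

theorem not_admitsRegularLeftOrder_coprodI {ι : Type u} {G : ι → Type v} [∀ i, Group (G i)]
    {i j : ι} (hij : i ≠ j) [Nontrivial (G i)] [Nontrivial (G j)] :
    ¬ AdmitsRegularLeftOrder (CoprodI G) := by
  obtain ⟨a, ha⟩ := exists_ne (1 : G i)
  obtain ⟨b, hb⟩ := exists_ne (1 : G j)
  have : Nontrivial (CoprodI G) := (CoprodI.of_injective i).nontrivial
  refine not_admitsRegularLeftOrder_of_almostInvariant (S := {x | leadingIndex x = some i})
    (a := CoprodI.of a) (b := CoprodI.of b)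
    (fun y ↦ (finite_setOf_leadingIndex_mul_ne y).subset fun x hx h ↦ hx.2 (h.trans hx.1))
    (fun x hx ↦ leadingIndex_of_mul ha hx) fun x hx ↦ ?_
  have hbx : leadingIndex (CoprodI.of b * x) = some j :=
    leadingIndex_of_mul hb (by simpa [Set.mem_ofPred_eq.mp hx] using hij)
  simpa [hbx] using hij.symm

/-! ### Binary free products -/

section BinaryFactor

variable (A : Type u) (B : Type v)

/-- The two factors of a binary free product as a family, to be able to use indexed free
products. -/
def binaryFactor : Bool → Type (max u v)
  | true => ULift.{v} A
  | false => ULift.{u} B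

variable [Group A] [Group B]

instance (i : Bool) : Group (binaryFactor A B i) :=
  match i with
  | true => inferInstanceAs (Group (ULift A))
  | false => inferInstanceAs (Group (ULift B))

/-- The free product of two groups as an indexed free product. -/
def coprodMulEquivCoprodI : Coprod A B ≃* CoprodI (binaryFactor A B) :=
  MonoidHom.toMulEquiv
    (Coprod.lift
      ((CoprodI.of (M := binaryFactor A B) (i := true)).comp MulEquiv.ulift.symm.toMonoidHom)
      ((CoprodI.of (M := binaryFactor A B) (i := false)).comp MulEquiv.ulift.symm.toMonoidHom))
    (CoprodI.lift fun
      | true => Coprod.inl.comp MulEquiv.ulift.toMonoidHom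
      | false => Coprod.inr.comp MulEquiv.ulift.toMonoidHom)
    (Coprod.hom_ext rfl rfl)
    (CoprodI.ext_hom _ _ (Bool.forall_bool.2 ⟨rfl, rfl⟩))

end BinaryFactor

theorem mainTheorem4_general (A : Type u) (B : Type v) [Group A] [Group B] :
    (AdmitsRegularLeftOrder A → AdmitsRegularLeftOrder B →
      AdmitsRegularLeftOrder (Monoid.Coprod A B × Multiplicative ℤ)) ∧
      (Nontrivial A → Nontrivial B → ¬ AdmitsRegularLeftOrder (Monoid.Coprod A B)) := by
  let e := coprodMulEquivCoprodI A B
  refine ⟨fun hA hB ↦ ?_, fun _ _ h ↦ ?_⟩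
  · have hfactor : ∀ i, AdmitsRegularLeftOrder (binaryFactor A B i) :=
      Bool.forall_bool.2 ⟨hB.of_mulEquiv MulEquiv.ulift.symm, hA.of_mulEquiv MulEquiv.ulift.symm⟩
    exact (admitsRegularLeftOrder_coprodI_prod_int hfactor).of_mulEquiv
      (e.symm.prodCongr (MulEquiv.refl _))
  · have : Nontrivial (binaryFactor A B true) := inferInstanceAs (Nontrivial (ULift A))
    have : Nontrivial (binaryFactor A B false) := inferInstanceAs (Nontrivial (ULift B))
    exact not_admitsRegularLeftOrder_coprodI Bool.false_ne_true (h.of_mulEquiv e)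

theorem mainTheorem4 (A : Type u) (B : Type v) [Group A] [Group B]
    (hA : AdmitsRegularLeftOrder A) (hB : AdmitsRegularLeftOrder B) :
    AdmitsRegularLeftOrder (Monoid.Coprod A B × Multiplicative ℤ) ∧
      (Nontrivial A → Nontrivial B → ¬ AdmitsRegularLeftOrder (Monoid.Coprod A B)) :=
  ⟨(mainTheorem4_general A B).1 hA hB, (mainTheorem4_general A B).2⟩
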